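/- Let $\gamma\colon[a,b]\to\mathbb{R}^2$, $a<b$, be a simple smooth loop; that is, $\gamma$ is infinitely differentiable on $[a,b]$ (with one-sided derivatives at the ends), $\gamma'(t)\neq 0$ for every $t\in[a,b]$, $\gamma(a)=\gamma(b)$, and $\gamma$ is injective on $[a,b)$. (The one-sided velocities $\gamma'(a)$ and $\gamma'(b)$ may differ, so the loop may have a corner at its base point $\gamma(a)=\gamma(b)$.) Suppose that its unsigned curvature $$\kappa(t)=\frac{|T'(t)|}{|\gamma'(t)|},\qquad T(t)=\frac{\gamma'(t)}{|\gamma'(t)|},$$ satisfies $\kappa(t)\le 1$ for all $t\in[a,b]$. Let $F$ be the closed figure bounded by $\gamma$, that is, the union of $\gamma([a,b])$ with the bounded component of its complement in the plane. Then $F$ contains a closed disc of radius $1$. -/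

import Mathlib

open scoped ContDiff

/-- The Euclidean plane. -/
abbrev Plane : Type := EuclideanSpace ℝ (Fin 2)

/-- The velocity of a curve parametrized by `[a, b]` (one-sided at the ends of the interval). -/
noncomputable def velocity (γ : ℝ → Plane) (a b t : ℝ) : Plane :=
  derivWithin γ (Set.Icc a b) t

/-- `γ`, restricted to `[a, b]`, is a simple smooth loop with base point `γ a = γ b`: it is smooth
and regular on `[a, b]` up to the ends, its ends coincide, and it has no other self-intersections.
The two one-sided velocities at the base point are not related to each other, so the loop may have
a corner or a cusp there. -/
structure IsSimpleSmoothLoop (γ : ℝ → Plane) (a b : ℝ) : Prop where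
  lt : a < b
  smooth : ContDiffOn ℝ ∞ γ (Set.Icc a b)
  regular : ∀ t ∈ Set.Icc a b, velocity γ a b t ≠ 0
  closed : γ a = γ b
  simple : Set.InjOn γ (Set.Ico a b)

/-- The tangent indicatrix `γ' / |γ'|`. -/
noncomputable def tangentIndicatrix (γ : ℝ → Plane) (a b t : ℝ) : Plane :=
  ‖velocity γ a b t‖⁻¹ • velocity γ a b t

/-- The unsigned curvature of a smooth regular curve parametrized by `[a, b]`, that is, the speed of
the tangent indicatrix with respect to arc length. -/
noncomputable def curvature (γ : ℝ → Plane) (a b t : ℝ) : ℝ :=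
  ‖derivWithin (tangentIndicatrix γ a b) (Set.Icc a b) t‖ / ‖velocity γ a b t‖

/-- The closed figure bounded by a closed curve `C` in the plane: the curve together with all
points of the bounded connected components of its complement. -/
def boundedFigure (C : Set Plane) : Set Plane :=
  C ∪ {x | x ∉ C ∧ Bornology.IsBounded (connectedComponentIn Cᶜ x)}

/-!
The disc is found inside the complement of the exterior of the loop, the exterior being the union of
the unbounded components of the complement of the loop. Suppose that no closed unit disc fits. Then
all discs that are centred off the exterior and have no points of the loop in their interior have
radius at most some `R < 1`.

Curvature at most `1` enters through one local fact
(`IsCurvedLoop.norm_sub_lt_of_orthogonal`): if the radius from `c` to `g t` is normal to the loop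
and shorter than `1`, then `g t` is strictly nearer to `c` than all neighbouring points of the loop.
So a touching disc touches at isolated points, and the largest disc that touches at a given point
from the inner side has a second contact (`IsCurvedLoop.exists_bitangent`). The two parameters of
such a pair of contacts are a definite distance apart
(`IsCurvedLoop.exists_le_abs_sub_of_bitangent`), so by compactness some pair `t < s` has the least
`s - t`. The disc touching at the midpoint `m` of `[t, s]` has a second contact too, which by
minimality is not on the arc over `[t, s]`. Hence the two pairs of radii have interlaced ends, and
they cross (`IsCurvedLoop.exists_mem_segment_of_interlaced`). But where two radii to nearest points
cross, their ends are equally near, so that the second disc also touches at `t` or `s`: this pair,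
together with `m`, is shorter. A corner at the base point does no harm, because radii are required
to be normal to the loop only at contacts other than the base point.

The plane topology is done without the Jordan curve theorem, by winding numbers written as
logarithmic integrals. For a closed curve such an integral is constant on connected sets off the
curve, and it jumps by `2πi` where the curve is crossed at a regular point
(`tendsto_pathLog_jump`). This gives the inner side of the loop
(`IsCurvedLoop.exists_outward`, `IsCurvedLoop.not_eventually_inward_mem_exterior`) and the crossing
of interlaced pairs of radii.
-/

open Set Filter Topology Complex

/-! ### Logarithmic integrals along paths -/

/-- The logarithmic integral `∫ df / (f - x)` along the path `f` with velocity `f'` over `[t, s]`. -/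
noncomputable def pathLog (f f' : ℝ → ℂ) (t s : ℝ) (x : ℂ) : ℂ :=
  ∫ u in t..s, f' u / (f u - x)

theorem continuousOn_pathLog_integrand {f f' : ℝ → ℂ} (hf : Continuous f) (hf' : Continuous f')
    {x : ℂ} {S : Set ℝ} (hx : ∀ u ∈ S, f u ≠ x) :
    ContinuousOn (fun u => f' u / (f u - x)) S :=
  hf'.continuousOn.div (by fun_prop) fun u hu => sub_ne_zero.2 (hx u hu)

/-- The logarithmic integral is a logarithm of the ratio of the end values of `f - x`; so its sum
over the pieces of a closed curve is a logarithm of `1`. -/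
theorem exp_pathLog {f f' : ℝ → ℂ} (hf : Continuous f) (hf' : Continuous f') {t s : ℝ}
    (hts : t ≤ s) (hd : ∀ u ∈ Ioo t s, HasDerivAt f (f' u) u) {x : ℂ}
    (hx : ∀ u ∈ Icc t s, f u ≠ x) :
    exp (pathLog f f' t s x) * (f t - x) = f s - x := by
  have hF := continuousOn_pathLog_integrand hf hf' hx
  have hint : IntervalIntegrable (fun u => f' u / (f u - x)) MeasureTheory.volume t s :=
    hF.intervalIntegrable_of_Icc hts
  have key : ∫ u in t..s, (0 : ℂ) =
      exp (-pathLog f f' t s x) * (f s - x) - exp (-pathLog f f' t t x) * (f t - x) := by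
    symm
    refine (intervalIntegral.integral_eq_sub_of_hasDeriv_right_of_le
      (f := fun u => exp (-pathLog f f' t u x) * (f u - x)) hts ?_ ?_ (by simp)).symm
    · refine ContinuousOn.mul (ContinuousOn.cexp (ContinuousOn.neg ?_)) (by fun_prop)
      have := intervalIntegral.continuousOn_primitive_interval (μ := MeasureTheory.volume)
        (f := fun u => f' u / (f u - x)) (a := t) (b := s)
        (by rw [uIcc_of_le hts]; exact hF.integrableOn_Icc)
      rwa [uIcc_of_le hts] at this
    · intro u hu
      have hne : f u - x ≠ 0 := sub_ne_zero.2 (hx u (Ioo_subset_Icc_self hu))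
      have h1 : HasDerivAt (fun u => pathLog f f' t u x) (f' u / (f u - x)) u := by
        refine intervalIntegral.integral_hasDerivAt_right
          ((hF.mono (Icc_subset_Icc_right hu.2.le)).intervalIntegrable_of_Icc hu.1.le) ?_ ?_
        · exact (hF.mono Ioo_subset_Icc_self).stronglyMeasurableAtFilter isOpen_Ioo u hu
        · exact (hF.mono Ioo_subset_Icc_self).continuousAt (isOpen_Ioo.mem_nhds hu)
      have h2 := (h1.neg.cexp).mul ((hd u hu).sub_const x)
      have h3 : HasDerivAt (fun u => exp (-pathLog f f' t u x) * (f u - x)) 0 u := by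
        refine h2.congr_deriv ?_
        simp only [Pi.neg_apply]
        field_simp
        ring
      exact h3.hasDerivWithinAt
  have h0 : pathLog f f' t t x = 0 := by simp [pathLog]
  rw [h0, Complex.exp_neg] at key
  simp only [intervalIntegral.integral_zero, neg_zero, Complex.exp_zero, one_mul] at key
  have hE := Complex.exp_ne_zero (pathLog f f' t s x)
  field_simp at key
  linear_combination key

theorem continuousAt_pathLog {f f' : ℝ → ℂ} (hf : Continuous f) (hf' : Continuous f') {t s : ℝ}
    (hts : t ≤ s) {x : ℂ} (hx : ∀ u ∈ Icc t s, f u ≠ x) :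
    ContinuousAt (pathLog f f' t s) x := by
  obtain ⟨d, hd, hdx⟩ : ∃ d > 0, ∀ u ∈ Icc t s, d ≤ ‖f u - x‖ := by
    obtain ⟨u0, hu0, h⟩ := isCompact_Icc.exists_isMinOn (nonempty_Icc.2 hts)
      (f := fun u => ‖f u - x‖) (by fun_prop)
    exact ⟨_, norm_pos_iff.2 (sub_ne_zero.2 (hx u0 hu0)), fun u hu => h hu⟩
  obtain ⟨B, hB⟩ := isCompact_Icc.exists_bound_of_continuousOn (s := Icc t s) hf'.continuousOn
  have hev : ∀ᶠ y in 𝓝 x, ∀ u ∈ Icc t s, d / 2 ≤ ‖f u - y‖ := by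
    filter_upwards [Metric.ball_mem_nhds x (half_pos hd)] with y hy u hu
    have h1 := hdx u hu
    have h2 : ‖f u - x‖ ≤ ‖f u - y‖ + ‖y - x‖ := by
      simpa using norm_add_le (f u - y) (y - x)
    have h3 : ‖y - x‖ < d / 2 := by simpa [dist_eq_norm] using hy
    linarith
  refine intervalIntegral.continuousAt_of_dominated_interval (bound := fun _ => B / (d / 2))
    ?_ ?_ (by simp) ?_
  · filter_upwards [hev] with y hy
    refine ContinuousOn.aestronglyMeasurable ?_ measurableSet_uIoc
    rw [uIoc_of_le hts]
    refine continuousOn_pathLog_integrand hf hf' fun u hu h => ?_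
    have := hy u (Ioc_subset_Icc_self hu)
    simp [h] at this
    linarith
  · filter_upwards [hev] with y hy
    refine Eventually.of_forall fun u hu => ?_
    rw [uIoc_of_le hts] at hu
    have hu' := Ioc_subset_Icc_self hu
    rw [norm_div]
    have h0 : 0 ≤ B := (norm_nonneg _).trans (hB u hu')
    exact div_le_div₀ h0 (hB u hu') (by positivity) (hy u hu')
  · refine Eventually.of_forall fun u hu => ?_
    rw [uIoc_of_le hts] at hu
    exact continuousAt_const.div (by fun_prop)
      (sub_ne_zero.2 (hx u (Ioc_subset_Icc_self hu)))

/-- A continuous logarithm of `1` is constant on preconnected sets. -/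
theorem eq_of_isPreconnected_of_exp_eq_one {W : ℂ → ℂ} {S : Set ℂ} (hS : IsPreconnected S)
    (hc : ContinuousOn W S) (h : ∀ x ∈ S, exp (W x) = 1) {x y : ℂ} (hx : x ∈ S) (hy : y ∈ S) :
    W x = W y := by
  have hmem : ∀ x ∈ S, ∃ n : ℤ, (n : ℝ) = (W x).im / (2 * Real.pi) := fun x hx => by
    obtain ⟨n, hn⟩ := Complex.exp_eq_one_iff.1 (h x hx)
    refine ⟨n, ?_⟩
    rw [hn]
    have := Real.pi_ne_zero
    simp
  have : IsDiscrete (range ((↑) : ℤ → ℝ)) :=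
    Int.isClosedEmbedding_coe_real.isEmbedding.isDiscrete_range
  have him : (W x).im / (2 * Real.pi) = (W y).im / (2 * Real.pi) :=
    hS.constant_of_mapsTo this (T := range ((↑) : ℤ → ℝ)) (f := fun x => (W x).im / (2 * Real.pi))
      ((Complex.continuous_im.comp_continuousOn hc).div_const _) hmem hx hy
  have hre : ∀ x ∈ S, (W x).re = 0 := fun x hx => by
    obtain ⟨n, hn⟩ := Complex.exp_eq_one_iff.1 (h x hx)
    simp [hn]
  refine Complex.ext ((hre x hx).trans (hre y hy).symm) ?_
  have := Real.pi_pos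
  field_simp at him
  linarith

/-- The logarithmic integral of a path that keeps to a rotated slit plane is a difference of
logarithms. -/
theorem pathLog_eq_log_sub_log {f f' : ℝ → ℂ} (hf : Continuous f) (hf' : Continuous f') {t s : ℝ}
    (hts : t ≤ s) (hd : ∀ u ∈ Ioo t s, HasDerivAt f (f' u) u) {x e : ℂ}
    (hx : ∀ u ∈ Icc t s, e * (f u - x) ∈ slitPlane) :
    pathLog f f' t s x = log (e * (f s - x)) - log (e * (f t - x)) := by
  have hne : ∀ u ∈ Icc t s, f u ≠ x := fun u hu h => by
    have := hx u hu
    simp [h] at this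
  have he : ∀ u ∈ Icc t s, e ≠ 0 := fun u hu h => by
    have := hx u hu
    simp [h] at this
  refine intervalIntegral.integral_eq_sub_of_hasDeriv_right_of_le
      (f := fun u => log (e * (f u - x))) hts ?_ ?_
      ((continuousOn_pathLog_integrand hf hf' hne).intervalIntegrable_of_Icc hts)
  · exact ContinuousOn.clog (by fun_prop) hx
  · intro u hu
    have hu' := Ioo_subset_Icc_self hu
    have h1 := (((hd u hu).sub_const x).const_mul e).clog_real (hx u hu')
    convert h1.hasDerivWithinAt using 1
    have := sub_ne_zero.2 (hne u hu')
    have := he u hu'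
    field_simp

theorem pathLog_add {f f' : ℝ → ℂ} (hf : Continuous f) (hf' : Continuous f') {t m s : ℝ}
    (htm : t ≤ m) (hms : m ≤ s) {x : ℂ} (hx : ∀ u ∈ Icc t s, f u ≠ x) :
    pathLog f f' t m x + pathLog f f' m s x = pathLog f f' t s x := by
  have hF := continuousOn_pathLog_integrand hf hf' hx
  exact intervalIntegral.integral_add_adjacent_intervals
    ((hF.mono (Icc_subset_Icc_right hms)).intervalIntegrable_of_Icc htm)
    ((hF.mono (Icc_subset_Icc_left htm)).intervalIntegrable_of_Icc hms)

/-! ### The jump of the logarithmic integral across a path -/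

theorem log_sub_log_neg_of_im_pos {z : ℂ} (hz : 0 < z.im) : log z - log (-z) = Real.pi * I := by
  rw [log, log, norm_neg, arg_neg_eq_arg_sub_pi_of_im_pos hz]
  push_cast
  ring

/-- The part of the jump formula that takes place near the crossing: on both sides of the curve the
integral over a short arc is a difference of logarithms, but on opposite slit planes. -/
theorem tendsto_pathLog_jump_of_re {g v : ℝ → ℂ} (hg : Continuous g) (hv : Continuous v)
    {l m r : ℝ} (hlm : l < m) (hmr : m < r) (hd : ∀ u ∈ Ioo l r, HasDerivAt g (v u) u) {τ : ℂ}
    (hτ : τ ≠ 0) (hpos : ∀ u ∈ Ioc m r, 0 < ((g u - g m) / τ).re)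
    (hneg : ∀ u ∈ Ico l m, ((g u - g m) / τ).re < 0) :
    (∀ e : ℝ, 0 < e → (∀ u ∈ Icc l r, g u ≠ g m + e * (I * τ)) ∧
      ∀ u ∈ Icc l r, g u ≠ g m - e * (I * τ)) ∧
    Tendsto (fun e : ℝ => pathLog g v l r (g m + e * (I * τ)) -
      pathLog g v l r (g m - e * (I * τ))) (𝓝[>] 0) (𝓝 (2 * Real.pi * I)) := by
  -- Rotated so that the normal `I * τ` points along the negative or positive real axis, the arc as
  -- seen from a point of the normal misses the cut of the principal logarithm.
  have hsl1 : ∀ e : ℝ, 0 < e → ∀ u ∈ Icc l r,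
      (I / τ) * (g u - (g m + e * (I * τ))) ∈ slitPlane := fun e he u hu => by
    have h : (I / τ) * (g u - (g m + e * (I * τ))) = I * ((g u - g m) / τ) + e := by
      field_simp
      linear_combination -(e * τ : ℂ) * I_sq
    rw [h, mem_slitPlane_iff]
    rcases lt_trichotomy u m with h1 | rfl | h1
    · right
      simpa using (hneg u ⟨hu.1, h1⟩).ne
    · left
      simpa using he
    · right
      simpa using (hpos u ⟨h1, hu.2⟩).ne'
  have hsl2 : ∀ e : ℝ, 0 < e → ∀ u ∈ Icc l r,
      (-I / τ) * (g u - (g m - e * (I * τ))) ∈ slitPlane := fun e he u hu => by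
    have h : (-I / τ) * (g u - (g m - e * (I * τ))) = -I * ((g u - g m) / τ) + e := by
      field_simp
      linear_combination -(e * τ : ℂ) * I_sq
    rw [h, mem_slitPlane_iff]
    rcases lt_trichotomy u m with h1 | rfl | h1
    · right
      simpa using (hneg u ⟨hu.1, h1⟩).ne
    · left
      simpa using he
    · right
      simpa using (hpos u ⟨h1, hu.2⟩).ne'
  have hlr := (hlm.trans hmr).le
  constructor
  · refine fun e he => ⟨fun u hu h => ?_, fun u hu h => ?_⟩
    · simpa [h] using hsl1 e he u hu
    · simpa [h] using hsl2 e he u hu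
  -- The two branches of the logarithm differ by `πi` at one end of the arc and by `-πi` at the other.
  have hr := hpos r ⟨hmr, le_rfl⟩
  have hl := hneg l ⟨le_rfl, hlm⟩
  have e1 : log (I / τ * (g r - g m)) - log (-I / τ * (g r - g m)) = Real.pi * I := by
    have h : -I / τ * (g r - g m) = -(I / τ * (g r - g m)) := by ring
    rw [h]
    refine log_sub_log_neg_of_im_pos ?_
    rw [show I / τ * (g r - g m) = I * ((g r - g m) / τ) by ring]
    simpa using hr
  have e2 : log (-I / τ * (g l - g m)) - log (I / τ * (g l - g m)) = Real.pi * I := by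
    have h : I / τ * (g l - g m) = -(-I / τ * (g l - g m)) := by ring
    rw [h]
    refine log_sub_log_neg_of_im_pos ?_
    rw [show -I / τ * (g l - g m) = -I * ((g l - g m) / τ) by ring]
    simpa using hl
  have main : Tendsto (fun e : ℝ =>
      (log (I / τ * (g r - (g m + e * (I * τ)))) - log (I / τ * (g l - (g m + e * (I * τ))))) -
      (log (-I / τ * (g r - (g m - e * (I * τ)))) - log (-I / τ * (g l - (g m - e * (I * τ))))))
      (𝓝[>] 0) (𝓝 (2 * Real.pi * I)) := by
    have hc : ∀ (w z σ : ℂ), w * (z - g m) ∈ slitPlane → Tendsto (fun e : ℝ =>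
        log (w * (z - (g m + e * σ)))) (𝓝[>] 0) (𝓝 (log (w * (z - g m)))) := by
      intro w z σ h
      have h1 : ContinuousAt (fun e : ℝ => log (w * (z - (g m + e * σ)))) 0 := by
        refine ContinuousAt.clog (by fun_prop) (by simpa using h)
      simpa using h1.tendsto.mono_left (nhdsWithin_le_nhds (s := Ioi 0))
    have m1 : I / τ * (g r - g m) ∈ slitPlane := by
      rw [show I / τ * (g r - g m) = I * ((g r - g m) / τ) by ring, mem_slitPlane_iff]
      right
      simpa using hr.ne'
    have m2 : -I / τ * (g r - g m) ∈ slitPlane := by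
      rw [show -I / τ * (g r - g m) = -I * ((g r - g m) / τ) by ring, mem_slitPlane_iff]
      right
      simpa using hr.ne'
    have m3 : I / τ * (g l - g m) ∈ slitPlane := by
      rw [show I / τ * (g l - g m) = I * ((g l - g m) / τ) by ring, mem_slitPlane_iff]
      right
      simpa using hl.ne
    have m4 : -I / τ * (g l - g m) ∈ slitPlane := by
      rw [show -I / τ * (g l - g m) = -I * ((g l - g m) / τ) by ring, mem_slitPlane_iff]
      right
      simpa using hl.ne
    have := ((hc _ _ (I * τ) m1).sub (hc _ _ (I * τ) m3)).sub
      ((hc _ _ (-(I * τ)) m2).sub (hc _ _ (-(I * τ)) m4))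
    convert this using 2
    · simp only [mul_neg, ← sub_eq_add_neg]
    · linear_combination -e1 - e2
  refine main.congr' ?_
  filter_upwards [self_mem_nhdsWithin] with e he
  rw [pathLog_eq_log_sub_log hg hv hlr hd (hsl1 e he),
    pathLog_eq_log_sub_log hg hv hlr hd (hsl2 e he)]

/-- The logarithmic integral along a curve jumps by `2πi` when the curve is crossed at a point where
it is regular and simple. -/
theorem tendsto_pathLog_jump {g v : ℝ → ℂ} (hg : Continuous g) (hv : Continuous v) {t m s : ℝ}
    (htm : t < m) (hms : m < s) (hd : ∀ u ∈ Ioo t s, HasDerivAt g (v u) u) {τ : ℂ}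
    (hτ : 0 < (v m / τ).re) (hinj : ∀ u ∈ Icc t s, g u = g m → u = m) :
    Tendsto (fun e : ℝ => pathLog g v t s (g m + e * (I * τ)) -
      pathLog g v t s (g m - e * (I * τ))) (𝓝[>] 0) (𝓝 (2 * Real.pi * I)) := by
  have hτ0 : τ ≠ 0 := by
    rintro rfl
    simp at hτ
  obtain ⟨δ, hδ, hball⟩ : ∃ δ > 0, Icc (m - δ) (m + δ) ⊆ Ioo t s ∩ {u | 0 < (v u / τ).re} := by
    have : Ioo t s ∩ {u | 0 < (v u / τ).re} ∈ 𝓝 m := by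
      refine inter_mem (Ioo_mem_nhds htm hms) ((isOpen_lt continuous_const ?_).mem_nhds hτ)
      fun_prop
    obtain ⟨δ, hδ, h⟩ := Metric.nhds_basis_closedBall.mem_iff.1 this
    exact ⟨δ, hδ, by rwa [Real.closedBall_eq_Icc] at h⟩
  have hl := hball (left_mem_Icc.2 (by linarith))
  have hr := hball (right_mem_Icc.2 (by linarith))
  set l := m - δ with hl_def
  set r := m + δ with hr_def
  have hlm : l < m := by linarith
  have hmr : m < r := by linarith
  have hmono : StrictMonoOn (fun u => ((g u - g m) / τ).re) (Icc l r) := by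
    refine strictMonoOn_of_deriv_pos (convex_Icc _ _) (by fun_prop) fun u hu => ?_
    rw [interior_Icc] at hu
    have hu' := hball (Ioo_subset_Icc_self hu)
    have h1 := ((hd u hu'.1).sub_const (g m)).div_const τ
    have h2 : HasDerivAt (fun u => ((g u - g m) / τ).re) (v u / τ).re u :=
      (reCLM.hasFDerivAt.comp_hasDerivAt u h1)
    rw [h2.deriv]
    exact hu'.2
  have hmem : m ∈ Icc l r := ⟨hlm.le, hmr.le⟩
  obtain ⟨hoff, hnear⟩ := tendsto_pathLog_jump_of_re hg hv hlm hmr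
    (fun u hu => hd u (hball (Ioo_subset_Icc_self hu)).1) hτ0
    (fun u hu => by
      simpa using hmono hmem ⟨hlm.le.trans hu.1.le, hu.2⟩ hu.1)
    (fun u hu => by
      simpa using hmono ⟨hu.1, hu.2.le.trans hmr.le⟩ hmem hu.2)
  have hfar1 : ∀ u ∈ Icc t l, g u ≠ g m := fun u hu h => by
    have := hinj u ⟨hu.1, hu.2.trans hl.1.2.le⟩ h
    linarith [hu.2]
  have hfar2 : ∀ u ∈ Icc r s, g u ≠ g m := fun u hu h => by
    have := hinj u ⟨hr.1.1.le.trans hu.1, hu.2⟩ h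
    linarith [hu.1]
  have hlim : ∀ σ : ℂ, Tendsto (fun e : ℝ => g m + e * σ) (𝓝[>] 0) (𝓝 (g m)) := fun σ => by
    have h1 : ContinuousAt (fun e : ℝ => g m + e * σ) 0 := by fun_prop
    simpa using h1.tendsto.mono_left (nhdsWithin_le_nhds (s := Ioi 0))
  have hcont : ∀ a b, a ≤ b → (∀ u ∈ Icc a b, g u ≠ g m) → Tendsto (fun e : ℝ =>
      pathLog g v a b (g m + e * (I * τ)) - pathLog g v a b (g m - e * (I * τ)))
      (𝓝[>] 0) (𝓝 0) := fun a b hab h => by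
    have hc := (continuousAt_pathLog hg hv hab h).tendsto
    have := (hc.comp (hlim (I * τ))).sub (hc.comp (hlim (-(I * τ))))
    simpa [Function.comp_def, ← sub_eq_add_neg] using this
  have hoff' : ∀ a b σ, (∀ u ∈ Icc a b, g u ≠ g m) →
      ∀ᶠ e : ℝ in 𝓝[>] 0, ∀ u ∈ Icc a b, g u ≠ g m + e * σ := fun a b σ h => by
    have hcl : IsClosed (g '' Icc a b) := (isCompact_Icc.image hg).isClosed
    have : (g '' Icc a b)ᶜ ∈ 𝓝 (g m) := hcl.isOpen_compl.mem_nhds (by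
      rintro ⟨u, hu, hu'⟩
      exact h u hu hu')
    filter_upwards [hlim σ this] with e he u hu hu'
    exact he ⟨u, hu, hu'⟩
  have hsum := ((hcont t l hl.1.1.le hfar1).add hnear).add (hcont r s hr.1.2.le hfar2)
  rw [zero_add, add_zero] at hsum
  refine hsum.congr' ?_
  filter_upwards [self_mem_nhdsWithin, hoff' t l (I * τ) hfar1, hoff' t l (-(I * τ)) hfar1,
    hoff' r s (I * τ) hfar2, hoff' r s (-(I * τ)) hfar2] with e he h1 h2 h3 h4
  simp only [mul_neg, ← sub_eq_add_neg] at h2 h4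
  have hall : ∀ x, (∀ u ∈ Icc t l, g u ≠ x) → (∀ u ∈ Icc l r, g u ≠ x) →
      (∀ u ∈ Icc r s, g u ≠ x) →
      pathLog g v t s x = pathLog g v t l x + pathLog g v l r x + pathLog g v r s x := by
    intro x k1 k2 k3
    have k12 : ∀ u ∈ Icc t r, g u ≠ x := fun u hu => by
      rcases le_total u l with h | h
      exacts [k1 u ⟨hu.1, h⟩, k2 u ⟨h, hu.2⟩]
    have k : ∀ u ∈ Icc t s, g u ≠ x := fun u hu => by
      rcases le_total u r with h | h
      exacts [k12 u ⟨hu.1, h⟩, k3 u ⟨h, hu.2⟩]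
    rw [pathLog_add hg hv hl.1.1.le (hlm.trans hmr).le k12, pathLog_add hg hv hr.1.1.le hr.1.2.le k]
  rw [hall _ h1 (hoff e he).1 h3, hall _ h2 (hoff e he).2 h4]
  ring

/-! ### The exterior of a compact plane set -/

/-- The union of the unbounded components of the complement of `C`. -/
def exterior (C : Set ℂ) : Set ℂ :=
  {x | x ∉ C ∧ ¬ Bornology.IsBounded (connectedComponentIn Cᶜ x)}

theorem isPreconnected_setOf_lt_norm_sub (p : ℂ) {M : ℝ} (hM : 0 ≤ M) :
    IsPreconnected {y : ℂ | M < ‖y - p‖} := by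
  have h : {y : ℂ | M < ‖y - p‖} =
      (fun q : ℝ × ℝ => p + q.1 * exp (q.2 * I)) '' (Ioi M ×ˢ univ) := by
    ext y
    constructor
    · intro hy
      refine ⟨(‖y - p‖, arg (y - p)), ⟨hy, mem_univ _⟩, ?_⟩
      simp [norm_mul_exp_arg_mul_I]
    · rintro ⟨⟨r, θ⟩, ⟨hr, -⟩, rfl⟩
      have hr' : M < r := hr
      have h0 : 0 < r := hM.trans_lt hr'
      simp [norm_exp_ofReal_mul_I, abs_of_pos h0, hr']
  rw [h]
  exact (isPreconnected_Ioi.prod isPreconnected_univ).image _ (by fun_prop)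

theorem subset_exterior {C S : Set ℂ} (hS : IsPreconnected S) (hSC : S ⊆ Cᶜ) {x : ℂ} (hxS : x ∈ S)
    (hx : x ∈ exterior C) : S ⊆ exterior C := by
  intro y hy
  refine ⟨hSC hy, ?_⟩
  rw [← connectedComponentIn_eq (hS.subset_connectedComponentIn hxS hSC hy)]
  exact hx.2

theorem mem_exterior_of_lt_norm {C : Set ℂ} {p : ℂ} {M : ℝ} (hM : 0 ≤ M)
    (hC : C ⊆ Metric.closedBall p M) {y : ℂ} (hy : M < ‖y - p‖) : y ∈ exterior C := by
  have hsub : {y : ℂ | M < ‖y - p‖} ⊆ Cᶜ := fun z hz hzC => by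
    have : ‖z - p‖ ≤ M := by simpa [dist_eq_norm] using hC hzC
    exact absurd hz (not_lt.2 this)
  refine ⟨hsub hy, fun hb => ?_⟩
  have hb' := hb.subset ((isPreconnected_setOf_lt_norm_sub p hM).subset_connectedComponentIn hy hsub)
  obtain ⟨R, hR⟩ := hb'.subset_closedBall p
  have : p + ((max M R + 1 : ℝ) : ℂ) ∈ {y : ℂ | M < ‖y - p‖} := by
    have h0 : 0 ≤ max M R := hM.trans (le_max_left _ _)
    simp only [mem_ofPred_eq, add_sub_cancel_left, norm_real, Real.norm_eq_abs]
    rw [abs_of_pos (by positivity)]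
    linarith [le_max_left M R]
  have := hR this
  have h0 : 0 ≤ max M R := hM.trans (le_max_left _ _)
  rw [Metric.mem_closedBall, dist_eq_norm, add_sub_cancel_left, norm_real, Real.norm_eq_abs,
    abs_of_pos (by positivity)] at this
  linarith [le_max_right M R]

theorem exterior_eq_connectedComponentIn {C : Set ℂ} {p : ℂ} {M : ℝ} (hM : 0 ≤ M)
    (hC : C ⊆ Metric.closedBall p M) {y : ℂ} (hy : M < ‖y - p‖) :
    exterior C = connectedComponentIn Cᶜ y := by
  have hyE := mem_exterior_of_lt_norm hM hC hy
  have hsub : {y : ℂ | M < ‖y - p‖} ⊆ Cᶜ := fun z hz => (mem_exterior_of_lt_norm hM hC hz).1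
  refine Subset.antisymm (fun x hx => ?_)
    (subset_exterior isPreconnected_connectedComponentIn (connectedComponentIn_subset _ _)
      (mem_connectedComponentIn hyE.1) hyE)
  obtain ⟨z, hz, hzM⟩ : ∃ z ∈ connectedComponentIn Cᶜ x, M < ‖z - p‖ := by
    by_contra! hcon
    refine hx.2 (Metric.isBounded_closedBall.subset (t := Metric.closedBall p M) fun z hz => ?_)
    simpa [dist_eq_norm] using hcon z hz
  have hzy : z ∈ connectedComponentIn Cᶜ y :=
    (isPreconnected_setOf_lt_norm_sub p hM).subset_connectedComponentIn hy hsub hzM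
  rw [connectedComponentIn_eq hzy, ← connectedComponentIn_eq hz]
  exact mem_connectedComponentIn hx.1

theorem exists_exterior_eq {C : Set ℂ} (hC : IsCompact C) :
    ∃ y, exterior C = connectedComponentIn Cᶜ y := by
  obtain ⟨M, hM⟩ := hC.isBounded.subset_closedBall 0
  have hM' : C ⊆ Metric.closedBall 0 |M| :=
    hM.trans (Metric.closedBall_subset_closedBall (le_abs_self M))
  refine ⟨((|M| + 1 : ℝ) : ℂ), exterior_eq_connectedComponentIn (abs_nonneg M) hM' ?_⟩
  rw [sub_zero, norm_real, Real.norm_eq_abs]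
  exact (lt_add_one _).trans_le (le_abs_self _)

theorem isOpen_exterior {C : Set ℂ} (hC : IsCompact C) : IsOpen (exterior C) := by
  obtain ⟨y, hy⟩ := exists_exterior_eq hC
  rw [hy]
  exact hC.isClosed.isOpen_compl.connectedComponentIn

theorem isPreconnected_exterior {C : Set ℂ} (hC : IsCompact C) : IsPreconnected (exterior C) := by
  obtain ⟨y, hy⟩ := exists_exterior_eq hC
  rw [hy]
  exact isPreconnected_connectedComponentIn

theorem ball_infDist_subset_compl (C : Set ℂ) (c : ℂ) :
    Metric.ball c (Metric.infDist c C) ⊆ Cᶜ :=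
  Metric.disjoint_ball_infDist.subset_compl_right

/-- A disc without points of `C` in its interior, and with its centre not in the exterior of `C`,
does not meet the exterior. -/
theorem closedBall_infDist_subset_compl_exterior {C : Set ℂ} (hC : IsCompact C) {c : ℂ}
    (hc : c ∉ exterior C) {r : ℝ} (hr : r ≤ Metric.infDist c C) :
    Metric.closedBall c r ⊆ (exterior C)ᶜ := by
  rcases le_or_gt r 0 with h0 | h0
  · intro x hx
    rw [Metric.mem_closedBall] at hx
    have : x = c := dist_le_zero.1 (hx.trans h0)
    rwa [this]
  have hball : Metric.ball c r ⊆ (exterior C)ᶜ := fun x hx hxE =>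
    hc (subset_exterior (convex_ball c r).isPreconnected
      ((Metric.ball_subset_ball hr).trans (ball_infDist_subset_compl C c)) hx hxE
        (Metric.mem_ball_self h0))
  rw [← closure_ball c h0.ne']
  exact (isOpen_exterior hC).isClosed_compl.closure_subset_iff.2 hball

/-! ### Loops of curvature at most one in the complex plane -/

/-- The unit vector in the direction of the velocity `v t`. -/
noncomputable def unitTangent (v : ℝ → ℂ) (t : ℝ) : ℂ := ‖v t‖⁻¹ • v t

/-- A simple loop `g` over `[a, b]` with velocity `v` and with unsigned curvature at most `1`; it is
smooth and regular except possibly at its base point. Outside of `[a, b]` the functions `g` and `v`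
are arbitrary continuous extensions. -/
structure IsCurvedLoop (g v : ℝ → ℂ) (a b : ℝ) : Prop where
  lt : a < b
  continuous : Continuous g
  continuous_vel : Continuous v
  hasDerivAt : ∀ t ∈ Ioo a b, HasDerivAt g (v t) t
  vel_ne : ∀ t, v t ≠ 0
  closed : g a = g b
  injOn : InjOn g (Ico a b)
  curv : ∀ t ∈ Ioo a b, ∃ k : ℂ, HasDerivAt (unitTangent v) k t ∧ ‖k‖ ≤ ‖v t‖

namespace IsCurvedLoop

variable {g v : ℝ → ℂ} {a b : ℝ}

theorem isCompact_image (h : IsCurvedLoop g v a b) : IsCompact (g '' Icc a b) :=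
  isCompact_Icc.image h.continuous

theorem norm_unitTangent (h : IsCurvedLoop g v a b) (t : ℝ) : ‖unitTangent v t‖ = 1 := by
  have := norm_ne_zero_iff.2 (h.vel_ne t)
  simp [unitTangent, this]

theorem continuous_unitTangent (h : IsCurvedLoop g v a b) : Continuous (unitTangent v) :=
  (h.continuous_vel.norm.inv₀ fun t => norm_ne_zero_iff.2 (h.vel_ne t)).smul h.continuous_vel

theorem vel_eq (h : IsCurvedLoop g v a b) (t : ℝ) : v t = ‖v t‖ • unitTangent v t := by
  have := norm_ne_zero_iff.2 (h.vel_ne t)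
  rw [unitTangent, smul_smul, mul_inv_cancel₀ this, one_smul]

theorem eq_of_apply_eq (h : IsCurvedLoop g v a b) {t s : ℝ} (ht : t ∈ Ioo a b) (hs : s ∈ Icc a b)
    (hst : g s = g t) : s = t := by
  rcases hs.2.eq_or_lt with rfl | hsb
  · exact absurd (h.injOn ⟨le_rfl, h.lt⟩ ⟨ht.1.le, ht.2⟩ (h.closed.trans hst)) ht.1.ne
  · exact h.injOn ⟨hs.1, hsb⟩ ⟨ht.1.le, ht.2⟩ hst

theorem exists_lipschitz (h : IsCurvedLoop g v a b) :
    ∃ L > 0, ∀ s ∈ Icc a b, ∀ t ∈ Icc a b, ‖g s - g t‖ ≤ L * |s - t| := by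
  obtain ⟨B, hB⟩ := isCompact_Icc.exists_bound_of_continuousOn (s := Icc a b)
    h.continuous_vel.continuousOn
  have hB0 : 0 ≤ B := (norm_nonneg _).trans (hB a (left_mem_Icc.2 h.lt.le))
  have h1 : LipschitzOnWith (B.toNNReal) g (Ioo a b) := by
    refine (convex_Ioo a b).lipschitzOnWith_of_nnnorm_hasDerivWithin_le (f' := v)
      (fun t ht => (h.hasDerivAt t ht).hasDerivWithinAt) fun t ht => ?_
    rw [← NNReal.coe_le_coe, coe_nnnorm, Real.coe_toNNReal _ hB0]
    exact hB t (Ioo_subset_Icc_self ht)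
  have h2 := h1.closure h.continuous.continuousOn
  rw [closure_Ioo h.lt.ne] at h2
  refine ⟨B + 1, by positivity, fun s hs t ht => ?_⟩
  have := h2.dist_le_mul s hs t ht
  rw [Real.coe_toNNReal _ hB0, dist_eq_norm, Real.dist_eq] at this
  nlinarith [abs_nonneg (s - t)]

/-- If the line through `c` and `g t` is normal to the loop at `t`, then `g t` is the strictly
nearest point to `c` on any arc around it that stays in the open unit disc around `c`: the function
`⟪g - c, T⟫` increases along the arc because its derivative is at least `‖v‖ (1 - ‖g - c‖)`. -/
theorem norm_sub_lt_of_orthogonal (h : IsCurvedLoop g v a b) {t s : ℝ} (ht : t ∈ Ioo a b)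
    (hs : s ∈ Icc a b) (hst : s ≠ t) {c : ℂ} (horth : inner ℝ (g t - c) (unitTangent v t) = 0)
    (hc : ∀ w ∈ uIcc t s, ‖g w - c‖ < 1) : ‖g t - c‖ < ‖g s - c‖ := by
  have hT := h.continuous_unitTangent
  have hg := h.continuous
  have hJ : uIcc t s ⊆ Icc a b := uIcc_subset_Icc (Ioo_subset_Icc_self ht) hs
  have hint : interior (uIcc t s) ⊆ Ioo a b := by
    rw [← interior_Icc]
    exact interior_mono hJ
  set φ : ℝ → ℝ := fun w => inner ℝ (g w - c) (unitTangent v w) with hφ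
  set f : ℝ → ℝ := fun w => ‖g w - c‖ ^ 2 with hf
  have hfc : ContinuousOn f (uIcc t s) := by fun_prop
  have hφmono : StrictMonoOn φ (uIcc t s) := by
    refine strictMonoOn_of_deriv_pos (convex_uIcc t s) (by fun_prop) fun w hw => ?_
    obtain ⟨k, hk, hkv⟩ := h.curv w (hint hw)
    have h1 := ((h.hasDerivAt w (hint hw)).sub_const c).inner ℝ hk
    rw [h1.deriv]
    have h2 : inner ℝ (v w) (unitTangent v w) = ‖v w‖ := by
      rw [h.vel_eq w, inner_smul_left, real_inner_self_eq_norm_sq, h.norm_unitTangent]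
      simp [h.norm_unitTangent]
    rw [h2]
    have h3 := abs_real_inner_le_norm (g w - c) k
    have h4 := hc w (interior_subset hw)
    have h5 := norm_pos_iff.2 (h.vel_ne w)
    have h6 := neg_abs_le (inner ℝ (g w - c) k)
    nlinarith [norm_nonneg (g w - c), norm_nonneg k]
  have hfd : ∀ w ∈ interior (uIcc t s), deriv f w = 2 * (‖v w‖ * φ w) := fun w hw => by
    have h1 := ((h.hasDerivAt w (hint hw)).sub_const c).norm_sq
    rw [hf, h1.deriv, hφ]
    congr 1
    conv_lhs => rw [h.vel_eq w]
    rw [inner_smul_right]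
  have h0 : φ t = 0 := horth
  have htm : t ∈ uIcc t s := left_mem_uIcc
  have hsm : s ∈ uIcc t s := right_mem_uIcc
  have hlt : f t < f s := by
    rcases lt_or_gt_of_ne hst with hlt | hlt
    · refine strictAntiOn_of_deriv_neg (convex_uIcc t s) hfc (fun w hw => ?_) hsm htm hlt
      rw [hfd w hw]
      have hw' : w < t := by
        rw [uIcc_of_ge hlt.le, interior_Icc] at hw
        exact hw.2
      have := hφmono (interior_subset hw) htm hw'
      have h5 := norm_pos_iff.2 (h.vel_ne w)
      nlinarith
    · refine strictMonoOn_of_deriv_pos (convex_uIcc t s) hfc (fun w hw => ?_) htm hsm hlt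
      rw [hfd w hw]
      have hw' : t < w := by
        rw [uIcc_of_le hlt.le, interior_Icc] at hw
        exact hw.1
      have := hφmono htm (interior_subset hw) hw'
      have h5 := norm_pos_iff.2 (h.vel_ne w)
      have h6 : 0 < φ w := by linarith
      positivity
  exact lt_of_pow_lt_pow_left₀ 2 (norm_nonneg _) hlt

/-- The radius from `c` to a nearest point of the loop is normal to the loop. -/
theorem orthogonal_of_nearest (h : IsCurvedLoop g v a b) {t : ℝ} (ht : t ∈ Ioo a b) {c : ℂ}
    (hmin : ∀ s ∈ Icc a b, ‖g t - c‖ ≤ ‖g s - c‖) :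
    inner ℝ (g t - c) (unitTangent v t) = 0 := by
  have h1 := ((h.hasDerivAt t ht).sub_const c).norm_sq
  have hloc : IsLocalMin (fun w => ‖g w - c‖ ^ 2) t := by
    filter_upwards [Icc_mem_nhds ht.1 ht.2] with s hs
    exact pow_le_pow_left₀ (norm_nonneg _) (hmin s hs) 2
  have h2 := hloc.hasDerivAt_eq_zero h1
  rw [unitTangent, inner_smul_right]
  simp only [mul_eq_zero, OfNat.ofNat_ne_zero, false_or] at h2
  rw [h2, mul_zero]

theorem inner_normal (t e : ℝ) :
    inner ℝ (g t - (g t + e * (I * unitTangent v t))) (unitTangent v t) = 0 := by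
  rw [sub_add_cancel_left, Complex.inner]
  simp
  ring

/-- Near a compact arc that avoids the base point, short normals on both sides do not meet the loop
again: nearby points of the loop are off them by the curvature bound, far ones by compactness. -/
theorem exists_collar (h : IsCurvedLoop g v a b) {t₀ t₁ : ℝ} (h₀ : a < t₀) (h₁ : t₁ < b) :
    ∃ η > 0, ∀ e : ℝ, 0 < |e| → |e| ≤ η → ∀ t ∈ Icc t₀ t₁,
      g t + e * (I * unitTangent v t) ∉ g '' Icc a b := by
  obtain ⟨L, hL, hLip⟩ := h.exists_lipschitz
  have hg := h.continuous
  have hsub : Icc t₀ t₁ ⊆ Ioo a b := fun t ht => ⟨h₀.trans_le ht.1, ht.2.trans_lt h₁⟩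
  set δ : ℝ := 1 / (4 * L) with hδ_def
  have hδ : 0 < δ := by positivity
  have hLδ : L * δ = 1 / 4 := by
    rw [hδ_def]
    field_simp
  obtain ⟨m, hm, hfar⟩ : ∃ m > 0, ∀ t ∈ Icc t₀ t₁, ∀ s ∈ Icc a b, δ ≤ |s - t| →
      m ≤ ‖g s - g t‖ := by
    set K : Set (ℝ × ℝ) := (Icc t₀ t₁ ×ˢ Icc a b) ∩ {q | δ ≤ |q.2 - q.1|} with hK
    have hKc : IsCompact K := (isCompact_Icc.prod isCompact_Icc).inter_right
      (isClosed_le continuous_const (by fun_prop))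
    rcases K.eq_empty_or_nonempty with hKe | hKn
    · refine ⟨1, one_pos, fun t ht s hs hts => ?_⟩
      exact absurd (show (t, s) ∈ K from ⟨⟨ht, hs⟩, hts⟩) (by simp [hKe])
    · obtain ⟨⟨t, s⟩, ⟨⟨ht, hs⟩, hts⟩, hmin⟩ := hKc.exists_isMinOn hKn
        (f := fun q : ℝ × ℝ => ‖g q.2 - g q.1‖) (by fun_prop)
      refine ⟨‖g s - g t‖, norm_pos_iff.2 (sub_ne_zero.2 fun heq => ?_), fun t' ht' s' hs' hts' =>
        hmin (show (t', s') ∈ K from ⟨⟨ht', hs'⟩, hts'⟩)⟩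
      have hst : s = t := h.eq_of_apply_eq (hsub ht) hs heq
      have hts' : δ ≤ |s - t| := hts
      rw [hst, sub_self, abs_zero] at hts'
      linarith
  refine ⟨min (1 / 2) (m / 2), by positivity, ?_⟩
  rintro e he0 he t ht ⟨s, hs, hgs⟩
  have hn : ‖(e : ℂ) * (I * unitTangent v t)‖ = |e| := by
    simp [h.norm_unitTangent]
  have hse : ‖g s - g t‖ = |e| := by rw [hgs, add_sub_cancel_left, hn]
  have hst : s ≠ t := by
    rintro rfl
    simp [hse.symm] at he0
  rcases le_or_gt δ |s - t| with hst' | hst'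
  · have := hfar t ht s hs hst'
    have := he.trans (min_le_right _ _)
    linarith
  · have hlt := h.norm_sub_lt_of_orthogonal (hsub ht) hs hst (inner_normal t e) fun w hw => by
      have hwI := uIcc_subset_Icc (Ioo_subset_Icc_self (hsub ht)) hs hw
      have h1 := hLip w hwI t (Ioo_subset_Icc_self (hsub ht))
      have h2 : |w - t| ≤ |s - t| := abs_sub_left_of_mem_uIcc hw
      have h3 : ‖g w - (g t + e * (I * unitTangent v t))‖ ≤
          ‖g w - g t‖ + ‖(e : ℂ) * (I * unitTangent v t)‖ := by
        rw [← sub_sub]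
        exact norm_sub_le _ _
      have h4 : L * |w - t| ≤ L * δ := by gcongr; linarith
      have := he.trans (min_le_left _ _)
      rw [hn] at h3
      linarith
    rw [hgs, sub_self, norm_zero] at hlt
    exact absurd hlt (not_lt.2 (norm_nonneg _))

end IsCurvedLoop

/-! ### The inner side and the bitangent discs -/

namespace IsCurvedLoop

variable {g v : ℝ → ℂ} {a b : ℝ}

/-- The jump of the logarithmic integral over `[t, s]` is seen on either normal direction, and it
cannot be compensated by a function that is continuous at the crossing. -/
theorem not_eventually_eq_across (h : IsCurvedLoop g v a b) {t m s : ℝ} (hat : a ≤ t) (htm : t < m)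
    (hms : m < s) (hsb : s ≤ b) {H : ℂ → ℂ} (hH : ContinuousAt H (g m)) {σ : ℝ} (hσ : |σ| = 1) :
    ¬ ∀ᶠ e : ℝ in 𝓝[>] 0,
      pathLog g v t s (g m + e * (σ * (I * unitTangent v m))) +
        H (g m + e * (σ * (I * unitTangent v m))) =
      pathLog g v t s (g m - e * (σ * (I * unitTangent v m))) +
        H (g m - e * (σ * (I * unitTangent v m))) := by
  intro hev
  have hm : m ∈ Ioo a b := ⟨hat.trans_lt htm, hms.trans_le hsb⟩
  have hv0 := norm_ne_zero_iff.2 (h.vel_ne m)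
  have hT0 : unitTangent v m ≠ 0 := by
    rw [← norm_ne_zero_iff, h.norm_unitTangent]
    exact one_ne_zero
  have hτ : 0 < (v m / unitTangent v m).re := by
    have h1 : v m / unitTangent v m = (‖v m‖ : ℂ) := by
      rw [div_eq_iff hT0, ← real_smul]
      exact h.vel_eq m
    rw [h1, ofReal_re]
    positivity
  have hJ := tendsto_pathLog_jump h.continuous h.continuous_vel htm hms
    (fun u hu => h.hasDerivAt u ⟨hat.trans_lt hu.1, hu.2.trans_le hsb⟩) hτ
    (fun u hu hgu => h.eq_of_apply_eq hm ⟨hat.trans hu.1, hu.2.trans hsb⟩ hgu)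
  have hlim : ∀ z : ℂ, Tendsto (fun e : ℝ => g m + e * z) (𝓝[>] 0) (𝓝 (g m)) := fun z => by
    have h1 : ContinuousAt (fun e : ℝ => g m + e * z) 0 := by fun_prop
    simpa using h1.tendsto.mono_left (nhdsWithin_le_nhds (s := Ioi 0))
  have hH' := (hH.tendsto.comp (hlim (I * unitTangent v m))).sub
    (hH.tendsto.comp (hlim (-(I * unitTangent v m))))
  have hsum := hJ.add hH'
  have hzero : (fun e : ℝ => pathLog g v t s (g m + e * (I * unitTangent v m)) -
      pathLog g v t s (g m - e * (I * unitTangent v m)) +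
      ((H ∘ fun e : ℝ => g m + e * (I * unitTangent v m)) e -
        (H ∘ fun e : ℝ => g m + e * (-(I * unitTangent v m))) e)) =ᶠ[𝓝[>] 0] fun _ => 0 := by
    filter_upwards [hev] with e he
    simp only [Function.comp_apply, mul_neg, ← sub_eq_add_neg]
    rcases eq_or_eq_neg_of_abs_eq hσ with rfl | rfl
    · simp only [ofReal_one, one_mul] at he
      linear_combination he
    · simp only [ofReal_neg, ofReal_one, neg_mul, one_mul, mul_neg, sub_neg_eq_add,
        ← sub_eq_add_neg] at he
      linear_combination -he
  have := tendsto_nhds_unique (hsum.congr' hzero) tendsto_const_nhds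
  simp [Real.pi_ne_zero, I_ne_zero] at this

theorem exp_pathLog_eq_one (h : IsCurvedLoop g v a b) {x : ℂ} (hx : x ∉ g '' Icc a b) :
    exp (pathLog g v a b x) = 1 := by
  have h1 := exp_pathLog h.continuous h.continuous_vel h.lt.le h.hasDerivAt (x := x)
    fun u hu hux => hx ⟨u, hu, hux⟩
  rw [← h.closed] at h1
  exact mul_right_cancel₀ (sub_ne_zero.2 fun hax => hx ⟨a, left_mem_Icc.2 h.lt.le, hax⟩)
    (h1.trans (one_mul _).symm)

theorem pathLog_eq_of_mem_exterior (h : IsCurvedLoop g v a b) {x y : ℂ}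
    (hx : x ∈ exterior (g '' Icc a b)) (hy : y ∈ exterior (g '' Icc a b)) :
    pathLog g v a b x = pathLog g v a b y :=
  eq_of_isPreconnected_of_exp_eq_one (isPreconnected_exterior h.isCompact_image)
    (fun _ hz => (continuousAt_pathLog h.continuous h.continuous_vel h.lt.le
      fun u hu huz => hz.1 ⟨u, hu, huz⟩).continuousWithinAt)
    (fun _ hz => h.exp_pathLog_eq_one hz.1) hx hy

/-- The exterior lies on the same side of the loop all along it. The side is found at a point
farthest from the base point, and it is carried along the loop in a collar. -/
theorem exists_outward (h : IsCurvedLoop g v a b) : ∃ σ : ℝ, |σ| = 1 ∧ ∀ t ∈ Ioo a b,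
    ∀ᶠ e : ℝ in 𝓝[>] 0, g t - e * (σ * (I * unitTangent v t)) ∈ exterior (g '' Icc a b) := by
  have hg := h.continuous
  have hT := h.continuous_unitTangent
  obtain ⟨t₀, ht₀, hmax⟩ := isCompact_Icc.exists_isMaxOn (nonempty_Icc.2 h.lt.le)
    (f := fun t => ‖g t - g a‖) (by fun_prop)
  have hmax' : ∀ t ∈ Icc a b, ‖g t - g a‖ ≤ ‖g t₀ - g a‖ := fun t ht => hmax ht
  have hM : 0 < ‖g t₀ - g a‖ := by
    have hmid : (a + b) / 2 ∈ Ioo a b := ⟨by linarith [h.lt], by linarith [h.lt]⟩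
    refine lt_of_lt_of_le (norm_pos_iff.2 (sub_ne_zero.2 fun heq => ?_))
      (hmax' _ (Ioo_subset_Icc_self hmid))
    exact hmid.1.ne (h.eq_of_apply_eq hmid (left_mem_Icc.2 h.lt.le) heq.symm)
  have ht₀' : t₀ ∈ Ioo a b := by
    refine ⟨lt_of_le_of_ne ht₀.1 ?_, lt_of_le_of_ne ht₀.2 ?_⟩
    · rintro rfl
      simp at hM
    · rintro rfl
      simp [← h.closed] at hM
  set M := ‖g t₀ - g a‖ with hM_def
  have horth : inner ℝ (g t₀ - g a) (unitTangent v t₀) = 0 := by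
    have h1 := ((h.hasDerivAt t₀ ht₀').sub_const (g a)).norm_sq
    have hloc : IsLocalMax (fun w => ‖g w - g a‖ ^ 2) t₀ := by
      filter_upwards [Icc_mem_nhds ht₀'.1 ht₀'.2] with s hs
      exact pow_le_pow_left₀ (norm_nonneg _) (hmax' s hs) 2
    have h2 := hloc.hasDerivAt_eq_zero h1
    rw [unitTangent, inner_smul_right]
    simp only [mul_eq_zero, OfNat.ofNat_ne_zero, false_or] at h2
    rw [h2, mul_zero]
  -- `g t₀ - g a` is normal to the loop at `t₀`, and it points to the exterior.
  obtain ⟨k, hk⟩ : ∃ k : ℝ, g t₀ - g a = k * (I * unitTangent v t₀) := by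
    have hn := h.norm_unitTangent t₀
    have hn2 : (unitTangent v t₀).re ^ 2 + (unitTangent v t₀).im ^ 2 = 1 := by
      have := Complex.sq_norm (unitTangent v t₀)
      rw [hn, normSq_apply] at this
      linarith
    rw [Complex.inner] at horth
    simp only [mul_re, conj_re, conj_im] at horth
    refine ⟨(g t₀ - g a).im * (unitTangent v t₀).re - (g t₀ - g a).re * (unitTangent v t₀).im, ?_⟩
    apply Complex.ext
    · simp only [mul_re, mul_im, ofReal_re, ofReal_im, I_re, I_im]
      linear_combination (unitTangent v t₀).re * horth - (g t₀ - g a).re * hn2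
    · simp only [mul_re, mul_im, ofReal_re, ofReal_im, I_re, I_im]
      linear_combination (unitTangent v t₀).im * horth - (g t₀ - g a).im * hn2
  have hkM : |k| = M := by
    rw [hM_def, hk]
    simp [h.norm_unitTangent]
  have hk0 : k ≠ 0 := by
    rintro rfl
    rw [abs_zero] at hkM
    linarith
  refine ⟨-(k / M), by rw [abs_neg, abs_div, hkM, abs_of_pos hM, div_self hM.ne'], ?_⟩
  have hσ : |-(k / M)| = 1 := by rw [abs_neg, abs_div, hkM, abs_of_pos hM, div_self hM.ne']
  have hout₀ : ∀ e : ℝ, 0 < e → g t₀ - e * ((-(k / M) : ℝ) * (I * unitTangent v t₀)) ∈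
      exterior (g '' Icc a b) := fun e he => by
    refine mem_exterior_of_lt_norm (p := g a) hM.le ?_ ?_
    · rintro _ ⟨t, ht, rfl⟩
      rw [Metric.mem_closedBall, dist_eq_norm]
      exact hmax' t ht
    · have h1 : g t₀ - e * ((-(k / M) : ℝ) * (I * unitTangent v t₀)) - g a =
          ((1 + e / M : ℝ) : ℂ) * (g t₀ - g a) := by
        have h2 : g t₀ - e * ((-(k / M) : ℝ) * (I * unitTangent v t₀)) - g a =
          (g t₀ - g a) + ((e / M : ℝ) : ℂ) * (k * (I * unitTangent v t₀)) := by
          push_cast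
          ring
        rw [h2, ← hk]
        push_cast
        ring
      rw [h1, norm_mul, norm_real, Real.norm_eq_abs, abs_of_pos (by positivity), ← hM_def]
      have : (1 + e / M) * M = M + e := by field_simp
      linarith
  intro t ht
  generalize -(k / M) = σ at hσ hout₀
  obtain ⟨η, hη, hcollar⟩ := h.exists_collar (t₀ := min t₀ t) (t₁ := max t₀ t)
    (lt_min ht₀'.1 ht.1) (max_lt ht₀'.2 ht.2)
  filter_upwards [Ioc_mem_nhdsGT hη] with e he
  refine subset_exterior (S := (fun s => g s - e * (σ * (I * unitTangent v s))) '' uIcc t₀ t)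
    (isPreconnected_uIcc.image _ (by fun_prop)) ?_ ⟨t₀, left_mem_uIcc, rfl⟩ (hout₀ e he.1)
    ⟨t, right_mem_uIcc, rfl⟩
  rintro _ ⟨s, hs, rfl⟩
  have habs : |-(e * σ)| = e := by rw [abs_neg, abs_mul, hσ, mul_one, abs_of_pos he.1]
  have := hcollar (-(e * σ)) (habs.symm ▸ he.1) (habs.le.trans he.2) s hs
  have heq : g s + ((-(e * σ) : ℝ) : ℂ) * (I * unitTangent v s) =
      g s - e * (σ * (I * unitTangent v s)) := by
    push_cast
    ring
  rwa [heq] at this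

theorem image_subset_closure_exterior (h : IsCurvedLoop g v a b) {σ : ℝ}
    (hout : ∀ t ∈ Ioo a b, ∀ᶠ e : ℝ in 𝓝[>] 0,
      g t - e * (σ * (I * unitTangent v t)) ∈ exterior (g '' Icc a b)) :
    g '' Icc a b ⊆ closure (exterior (g '' Icc a b)) := by
  rw [← closure_Ioo h.lt.ne]
  refine (image_closure_subset_closure_image h.continuous).trans
    (closure_minimal ?_ isClosed_closure)
  rintro _ ⟨t, ht, rfl⟩
  rw [closure_Ioo h.lt.ne]
  refine mem_closure_of_tendsto (b := 𝓝[>] (0 : ℝ)) ?_ (hout t ht)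
  have h1 : ContinuousAt (fun e : ℝ => g t - e * (σ * (I * unitTangent v t))) 0 := by fun_prop
  simpa using h1.tendsto.mono_left (nhdsWithin_le_nhds (s := Ioi 0))

/-- The exterior lies on one side of the loop only, because the winding number jumps. -/
theorem not_eventually_inward_mem_exterior (h : IsCurvedLoop g v a b) {σ : ℝ} (hσ : |σ| = 1)
    {t : ℝ} (ht : t ∈ Ioo a b) (hout : ∀ᶠ e : ℝ in 𝓝[>] 0,
      g t - e * (σ * (I * unitTangent v t)) ∈ exterior (g '' Icc a b)) :
    ¬ ∀ᶠ e : ℝ in 𝓝[>] 0,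
      g t + e * (σ * (I * unitTangent v t)) ∈ exterior (g '' Icc a b) := by
  intro hin
  refine h.not_eventually_eq_across le_rfl ht.1 ht.2 le_rfl (H := fun _ => 0) continuousAt_const hσ ?_
  filter_upwards [hin, hout] with e h1 h2
  rw [h.pathLog_eq_of_mem_exterior h1 h2]

/-- A closed disc that touches the loop at `t` from the inner side and has no points of the loop in
its interior has its centre off the exterior. -/
theorem center_notMem_exterior (h : IsCurvedLoop g v a b) {σ : ℝ} (hσ : |σ| = 1)
    {t : ℝ} (ht : t ∈ Ioo a b) (hout : ∀ᶠ e : ℝ in 𝓝[>] 0,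
      g t - e * (σ * (I * unitTangent v t)) ∈ exterior (g '' Icc a b)) {u : ℝ} (hu : 0 ≤ u)
    (hle : u ≤ Metric.infDist (g t + u * (σ * (I * unitTangent v t))) (g '' Icc a b)) :
    g t + u * (σ * (I * unitTangent v t)) ∉ exterior (g '' Icc a b) := by
  intro hext
  rcases hu.eq_or_lt with rfl | hu
  · exact hext.1 ⟨t, Ioo_subset_Icc_self ht, by simp⟩
  refine h.not_eventually_inward_mem_exterior hσ ht hout ?_
  filter_upwards [Ioc_mem_nhdsGT hu] with e he
  refine subset_exterior (convex_ball _ _).isPreconnected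
    ((Metric.ball_subset_ball hle).trans (ball_infDist_subset_compl _ _))
    (Metric.mem_ball_self hu) hext ?_
  have h1 : g t + e * (σ * (I * unitTangent v t)) - (g t + u * (σ * (I * unitTangent v t))) =
      ((e - u : ℝ) : ℂ) * (σ * (I * unitTangent v t)) := by
    push_cast
    ring
  rw [Metric.mem_ball, dist_eq_norm, h1]
  simp only [norm_mul, norm_real, Real.norm_eq_abs, norm_I, h.norm_unitTangent, hσ, mul_one]
  rw [abs_of_nonpos (by linarith [he.2])]
  linarith [he.1]

/-- At every point there is a disc that touches the loop from the inner side there and somewhere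
else: the largest disc on the inner normal without points of the loop in its interior. If it touched
the loop only once, it could be enlarged, because its radius is less than `1`. -/
theorem exists_bitangent (h : IsCurvedLoop g v a b) {σ : ℝ} (hσ : |σ| = 1)
    (hout : ∀ t ∈ Ioo a b, ∀ᶠ e : ℝ in 𝓝[>] 0,
      g t - e * (σ * (I * unitTangent v t)) ∈ exterior (g '' Icc a b)) {R : ℝ} (hR1 : R < 1)
    (hR : ∀ c ∉ exterior (g '' Icc a b), Metric.infDist c (g '' Icc a b) ≤ R) {t : ℝ}
    (ht : t ∈ Ioo a b) :
    ∃ u : ℝ, 0 < u ∧ ∃ s ∈ Icc a b, s ≠ t ∧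
      Metric.infDist (g t + u * (σ * (I * unitTangent v t))) (g '' Icc a b) = u ∧
      ‖g s - (g t + u * (σ * (I * unitTangent v t)))‖ = u := by
  have hg := h.continuous
  have htI := Ioo_subset_Icc_self ht
  obtain ⟨L, hL, hLip⟩ := h.exists_lipschitz
  set C := g '' Icc a b with hC
  have hCn : C.Nonempty := ⟨g t, t, htI, rfl⟩
  set n : ℂ := σ * (I * unitTangent v t) with hn
  have hn1 : ‖n‖ = 1 := by simp [hn, h.norm_unitTangent, hσ]
  have hgt : ∀ u : ℝ, 0 ≤ u → ‖g t - (g t + u * n)‖ = u := fun u hu => by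
    rw [sub_add_cancel_left, norm_neg, norm_mul, hn1, norm_real, Real.norm_eq_abs,
      abs_of_nonneg hu, mul_one]
  -- The radii of the discs that touch at `t`; the largest of them is at most `R < 1`.
  set A : Set ℝ := Icc 0 1 ∩ {u | u ≤ Metric.infDist (g t + u * n) C} with hA
  have hAc : IsCompact A := isCompact_Icc.inter_right
    (isClosed_le continuous_id ((Metric.continuous_infDist_pt C).comp (by fun_prop)))
  have hA0 : (0 : ℝ) ∈ A := ⟨by simp, Metric.infDist_nonneg⟩
  obtain ⟨u, ⟨⟨hu0, hu1⟩, huA⟩, hub⟩ := hAc.exists_isGreatest ⟨0, hA0⟩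
  have huA' : u ≤ Metric.infDist (g t + u * n) C := huA
  have hinf : Metric.infDist (g t + u * n) C = u := by
    refine le_antisymm ?_ huA'
    have := Metric.infDist_le_dist_of_mem (x := g t + u * n) (s := C) ⟨t, htI, rfl⟩
    rwa [dist_comm, dist_eq_norm, hgt u hu0] at this
  have huR : u ≤ R := by
    rw [← hinf]
    exact hR _ (h.center_notMem_exterior hσ ht (hout t ht) hu0 huA')
  obtain ⟨s, hs, hst, hsu⟩ : ∃ s ∈ Icc a b, s ≠ t ∧ ‖g s - (g t + u * n)‖ = u := by
    by_contra! hcon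
    -- The slightly larger radius `u + ε` belongs to `A`: points of the loop over `|s - t| < δ` stay
    -- out of the interior of the larger disc by the curvature bound, the others because they are
    -- outside the disc of radius `u` by `μ`.
    set δ := (1 - R) / (2 * L) with hδ_def
    have hδ : 0 < δ := div_pos (by linarith) (by positivity)
    have hLδ : L * δ = (1 - R) / 2 := by
      rw [hδ_def]
      field_simp
    obtain ⟨μ, hμ, hfar⟩ : ∃ μ > 0, ∀ s ∈ Icc a b, δ ≤ |s - t| →
        u + μ ≤ ‖g s - (g t + u * n)‖ := by
      set K : Set ℝ := Icc a b ∩ {s | δ ≤ |s - t|} with hK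
      have hKc : IsCompact K := isCompact_Icc.inter_right
        (isClosed_le continuous_const (by fun_prop))
      rcases K.eq_empty_or_nonempty with hKe | hKn
      · refine ⟨1, one_pos, fun s hs hst => ?_⟩
        exact absurd (show s ∈ K from ⟨hs, hst⟩) (by simp [hKe])
      · obtain ⟨s, ⟨hs, hst⟩, hmin⟩ := hKc.exists_isMinOn hKn
          (f := fun s => ‖g s - (g t + u * n)‖) (by fun_prop)
        have hst' : δ ≤ |s - t| := hst
        have hne : s ≠ t := by
          rintro rfl
          rw [sub_self, abs_zero] at hst'
          linarith
        have hge : u ≤ ‖g s - (g t + u * n)‖ := by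
          have := Metric.infDist_le_dist_of_mem (x := g t + u * n) (s := C) ⟨s, hs, rfl⟩
          rwa [dist_comm, dist_eq_norm, hinf] at this
        have hlt := lt_of_le_of_ne hge (hcon s hs hne).symm
        refine ⟨‖g s - (g t + u * n)‖ - u, by linarith, fun s' hs' hst' => ?_⟩
        have : ‖g s - (g t + u * n)‖ ≤ ‖g s' - (g t + u * n)‖ := hmin ⟨hs', hst'⟩
        linarith
    set ε := min ((1 - R) / 4) (μ / 2) with hε_def
    have hε : 0 < ε := lt_min (by linarith) (by linarith)
    have hε1 : ε ≤ (1 - R) / 4 := min_le_left _ _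
    have hε2 : ε ≤ μ / 2 := min_le_right _ _
    have hmem : u + ε ∈ A := by
      refine ⟨⟨by linarith, by linarith⟩, ?_⟩
      simp only [mem_ofPred_eq]
      rw [Metric.le_infDist hCn]
      rintro _ ⟨s, hs, rfl⟩
      rw [dist_comm, dist_eq_norm]
      rcases eq_or_ne s t with rfl | hst
      · exact (hgt _ (by linarith)).ge
      rcases le_or_gt δ |s - t| with hst' | hst'
      · have h1 := hfar s hs hst'
        have h2 : ‖g s - (g t + u * n)‖ ≤
            ‖g s - (g t + ((u + ε : ℝ) : ℂ) * n)‖ + ‖(ε : ℂ) * n‖ := by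
          refine le_trans (le_of_eq ?_) (norm_add_le _ _)
          congr 1
          push_cast
          ring
        rw [norm_mul, hn1, norm_real, Real.norm_eq_abs, abs_of_pos hε, mul_one] at h2
        linarith
      · have hlt := h.norm_sub_lt_of_orthogonal ht hs hst
          (c := g t + ((u + ε : ℝ) : ℂ) * n) (by
            have := inner_normal (g := g) (v := v) t ((u + ε) * σ)
            rw [hn]
            convert this using 4
            push_cast
            ring) fun w hw => by
          have h1 := hLip w (uIcc_subset_Icc htI hs hw) t htI
          have h2 : |w - t| ≤ |s - t| := abs_sub_left_of_mem_uIcc hw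
          have h3 := norm_add_le (g w - g t) (g t - (g t + ((u + ε : ℝ) : ℂ) * n))
          rw [sub_add_sub_cancel, hgt _ (by linarith)] at h3
          have h4 : L * |w - t| ≤ L * δ := by gcongr; linarith
          linarith
        rw [hgt _ (by linarith)] at hlt
        exact hlt.le
    have := hub hmem
    linarith
  refine ⟨u, lt_of_le_of_ne hu0 ?_, s, hs, hst, hinf, hsu⟩
  rintro rfl
  rw [ofReal_zero, zero_mul, add_zero, norm_eq_zero, sub_eq_zero] at hsu
  exact hst (h.eq_of_apply_eq ht hs hsu)

end IsCurvedLoop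

/-! ### Interlaced pairs of radii and the minimal pair of contacts -/

/-- The logarithmic integral along the segment from `p` to `q`. -/
noncomputable def segmentLog (p q x : ℂ) : ℂ :=
  pathLog (fun u : ℝ => p + u * (q - p)) (fun _ => q - p) 0 1 x

theorem add_mul_sub_mem_segment (p q : ℂ) {u : ℝ} (hu : u ∈ Icc (0 : ℝ) 1) :
    p + u * (q - p) ∈ segment ℝ p q := by
  rw [segment_eq_image']
  exact ⟨u, hu, by simp⟩

theorem exp_segmentLog {p q x : ℂ} (hx : x ∉ segment ℝ p q) :
    exp (segmentLog p q x) * (p - x) = q - x := by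
  have h := exp_pathLog (f := fun u : ℝ => p + u * (q - p)) (f' := fun _ => q - p) (x := x)
    (by fun_prop) continuous_const zero_le_one
    (fun u _ => by
      simpa using ((ofRealCLM.hasDerivAt (x := u)).mul_const (q - p)).const_add p)
    (fun u hu hux => hx (hux ▸ add_mul_sub_mem_segment p q hu))
  simpa [segmentLog] using h

theorem continuousAt_segmentLog {p q x : ℂ} (hx : x ∉ segment ℝ p q) :
    ContinuousAt (segmentLog p q) x :=
  continuousAt_pathLog (by fun_prop) continuous_const zero_le_one
    (fun _ hu hux => hx (hux ▸ add_mul_sub_mem_segment p q hu))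

namespace IsCurvedLoop

variable {g v : ℝ → ℂ} {a b : ℝ}

theorem segment_subset_compl_exterior (h : IsCurvedLoop g v a b) {c p : ℂ}
    (hc : c ∉ exterior (g '' Icc a b)) (hp : ‖p - c‖ = Metric.infDist c (g '' Icc a b)) :
    segment ℝ p c ⊆ (exterior (g '' Icc a b))ᶜ := by
  refine Subset.trans ?_ (closedBall_infDist_subset_compl_exterior h.isCompact_image hc le_rfl)
  refine (convex_closedBall _ _).segment_subset ?_
    (Metric.mem_closedBall_self Metric.infDist_nonneg)
  rw [Metric.mem_closedBall, dist_eq_norm, hp]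

theorem eq_of_mem_segment_of_mem {c p x : ℂ} {C : Set ℂ}
    (hp : ‖p - c‖ = Metric.infDist c C) (hx : x ∈ segment ℝ p c) (hxC : x ∈ C) : x = p := by
  have h1 := Metric.infDist_le_dist_of_mem (x := c) hxC
  rw [← hp, dist_comm, dist_eq_norm] at h1
  have h2 := mem_segment_iff_wbtw.1 hx
  have h3 := h2.dist_add_dist
  rw [dist_eq_norm, dist_eq_norm, dist_eq_norm] at h3
  have h4 : ‖p - x‖ ≤ 0 := by linarith
  exact (sub_eq_zero.1 (norm_le_zero_iff.1 h4)).symm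

/-- Two pairs of radii to nearest points cross if their ends on the loop are interlaced. Otherwise
the second pair would join, without crossing the closed curve made of the arc over `[t, s]` and the
first pair, the inner side of the arc at `m` to `g s'`, which lies on the boundary of the exterior.
So the winding number of that closed curve would not jump at `m`. -/
theorem exists_mem_segment_of_interlaced (h : IsCurvedLoop g v a b) {σ : ℝ} (hσ : |σ| = 1)
    (hout : ∀ t ∈ Ioo a b, ∀ᶠ e : ℝ in 𝓝[>] 0,
      g t - e * (σ * (I * unitTangent v t)) ∈ exterior (g '' Icc a b))
    {t m s : ℝ} (hat : a ≤ t) (htm : t < m) (hms : m < s) (hsb : s ≤ b) {c : ℂ}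
    (hc : c ∉ exterior (g '' Icc a b)) (htc : ‖g t - c‖ = Metric.infDist c (g '' Icc a b))
    (hsc : ‖g s - c‖ = Metric.infDist c (g '' Icc a b)) {u : ℝ} (hu : 0 < u) {c' : ℂ}
    (hc' : c' = g m + u * (σ * (I * unitTangent v m)))
    (hmc : Metric.infDist c' (g '' Icc a b) = u) {s' : ℝ} (hs' : s' ∈ Icc a b)
    (hs'c : ‖g s' - c'‖ = u) (hs't : g s' ∉ g '' Icc t s) :
    ∃ x, (x ∈ segment ℝ (g t) c ∨ x ∈ segment ℝ (g s) c) ∧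
      (x ∈ segment ℝ (g m) c' ∨ x ∈ segment ℝ (g s') c') := by
  by_contra! hcon
  set C := g '' Icc a b with hC
  set n : ℂ := σ * (I * unitTangent v m) with hn
  have hm : m ∈ Ioo a b := ⟨hat.trans_lt htm, hms.trans_le hsb⟩
  have hts := (htm.trans hms).le
  have hn1 : ‖n‖ = 1 := by simp [hn, h.norm_unitTangent, hσ]
  have hsubC : g '' Icc t s ⊆ C := image_mono (Icc_subset_Icc hat hsb)
  set H : ℂ → ℂ := fun x => segmentLog (g s) c x + segmentLog c (g t) x with hH
  set W : ℂ → ℂ := fun x => pathLog g v t s x + H x with hW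
  set N : Set ℂ := {x | x ∉ g '' Icc t s ∧ x ∉ segment ℝ (g t) c ∧ x ∉ segment ℝ (g s) c} with hN
  have hHc : ∀ x, x ∉ segment ℝ (g t) c → x ∉ segment ℝ (g s) c → ContinuousAt H x :=
    fun x h1 h2 => (continuousAt_segmentLog h2).add
      (continuousAt_segmentLog (by rwa [segment_symm]))
  have hWc : ∀ x ∈ N, ContinuousAt W x := fun x hx =>
    (continuousAt_pathLog h.continuous h.continuous_vel hts
      fun w hw hwx => hx.1 ⟨w, hw, hwx⟩).add (hHc x hx.2.1 hx.2.2)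
  have hWexp : ∀ x ∈ N, exp (W x) = 1 := fun x hx => by
    have h1 := exp_pathLog h.continuous h.continuous_vel hts
      (fun w hw => h.hasDerivAt w ⟨hat.trans_lt hw.1, hw.2.trans_le hsb⟩)
      (x := x) fun w hw hwx => hx.1 ⟨w, hw, hwx⟩
    have h2 := exp_segmentLog hx.2.2
    have h3 := exp_segmentLog (p := c) (q := g t) (x := x) (by rw [segment_symm]; exact hx.2.1)
    have h4 : g t - x ≠ 0 := sub_ne_zero.2 fun hgx => hx.1 ⟨t, left_mem_Icc.2 hts, hgx⟩
    simp only [hW, hH, Complex.exp_add]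
    refine mul_right_cancel₀ h4 ?_
    linear_combination h3 + exp (segmentLog c (g t) x) * h2 +
      exp (segmentLog c (g t) x) * exp (segmentLog (g s) c x) * h1
  have hconst : ∀ S : Set ℂ, IsPreconnected S → S ⊆ N → ∀ x ∈ S, ∀ y ∈ S, W x = W y :=
    fun S hS hSN x hx y hy => eq_of_isPreconnected_of_exp_eq_one hS
      (fun z hz => (hWc z (hSN hz)).continuousWithinAt) (fun z hz => hWexp z (hSN hz)) hx hy
  -- The exterior does not meet the closed curve.
  have hEN : exterior C ⊆ N := fun x hx => ⟨fun hx' => hx.1 (hsubC hx'),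
    fun hx' => h.segment_subset_compl_exterior hc htc hx' hx,
    fun hx' => h.segment_subset_compl_exterior hc hsc hx' hx⟩
  have hEconst := hconst _ (isPreconnected_exterior h.isCompact_image) hEN
  have hs'N : g s' ∈ N := ⟨hs't, fun hx => (hcon _ (Or.inl hx)).2 (left_mem_segment _ _ _),
    fun hx => (hcon _ (Or.inr hx)).2 (left_mem_segment _ _ _)⟩
  have hWs' : ∀ x ∈ exterior C, W (g s') = W x := by
    intro x hx
    have hcl := h.image_subset_closure_exterior hout ⟨s', hs', rfl⟩
    have := mem_closure_iff_nhdsWithin_neBot.1 hcl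
    refine tendsto_nhds_unique ((hWc _ hs'N).continuousWithinAt.tendsto (s := exterior C))
      (tendsto_const_nhds.congr' ?_)
    filter_upwards [self_mem_nhdsWithin] with y hy using hEconst x hx y hy
  -- Neither does the second pair of radii, apart from its end at `m`.
  have hmc' : ‖g m - c'‖ = u := by
    rw [hc', sub_add_cancel_left, norm_neg, norm_mul, hn1, norm_real, Real.norm_eq_abs,
      abs_of_pos hu, mul_one]
  set S : Set ℂ := (fun e : ℝ => g m + e * n) '' Ioc 0 u ∪ segment ℝ (g s') c' with hS
  have hSconn : IsPreconnected S := by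
    refine IsPreconnected.union c' ⟨u, ⟨hu, le_rfl⟩, hc'.symm⟩ (right_mem_segment _ _ _)
      (isPreconnected_Ioc.image _ (by fun_prop)) (convex_segment _ _).isPreconnected
  have hseg : ∀ e ∈ Ioc 0 u, g m + e * n ∈ segment ℝ (g m) c' := by
    intro e he
    rw [segment_eq_image']
    refine ⟨e / u, ⟨by have := he.1; positivity, (div_le_one hu).2 he.2⟩, ?_⟩
    have : (u : ℂ) ≠ 0 := ofReal_ne_zero.2 hu.ne'
    simp only [hc', add_sub_cancel_left, real_smul, ofReal_div]
    field_simp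
  have hSN : S ⊆ N := by
    rintro x (⟨e, he, rfl⟩ | hx)
    · have hx := hseg e he
      refine ⟨fun hx' => ?_, fun hx' => (hcon _ (Or.inl hx')).1 hx,
        fun hx' => (hcon _ (Or.inr hx')).1 hx⟩
      have := eq_of_mem_segment_of_mem (hmc'.trans hmc.symm) hx (hsubC hx')
      have hn0 : n ≠ 0 := norm_ne_zero_iff.1 (by rw [hn1]; exact one_ne_zero)
      have he0 : (e : ℂ) ≠ 0 := ofReal_ne_zero.2 he.1.ne'
      simp [hn0, he0] at this
    · refine ⟨fun hx' => ?_, fun hx' => (hcon _ (Or.inl hx')).2 hx,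
        fun hx' => (hcon _ (Or.inr hx')).2 hx⟩
      have := eq_of_mem_segment_of_mem (hs'c.trans hmc.symm) hx (hsubC hx')
      exact hs't (this ▸ hx')
  have hmem : g m ∈ segment ℝ (g m) c' := left_mem_segment _ _ _
  refine h.not_eventually_eq_across hat htm hms hsb (H := H)
    (hHc _ (fun hx => (hcon _ (Or.inl hx)).1 hmem) fun hx => (hcon _ (Or.inr hx)).1 hmem) hσ ?_
  filter_upwards [Ioc_mem_nhdsGT hu, hout m hm] with e he hext
  exact (hconst S hSconn hSN _ (Or.inl ⟨e, he, rfl⟩) _ (Or.inr (left_mem_segment _ _ _))).trans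
    (hWs' _ hext)

/-- If all discs without points of the loop in their interior have radius at most `R < 1`, then the
two contacts of such a disc with the loop are a definite distance apart. -/
theorem exists_le_abs_sub_of_bitangent (h : IsCurvedLoop g v a b) {R : ℝ} (hR1 : R < 1)
    (hR : ∀ c ∉ exterior (g '' Icc a b), Metric.infDist c (g '' Icc a b) ≤ R) :
    ∃ δ > 0, ∀ c ∉ exterior (g '' Icc a b), ∀ t ∈ Icc a b, ∀ s ∈ Icc a b, t < s →
      ‖g t - c‖ = Metric.infDist c (g '' Icc a b) →
      ‖g s - c‖ = Metric.infDist c (g '' Icc a b) → δ ≤ s - t := by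
  obtain ⟨L, hL, hLip⟩ := h.exists_lipschitz
  have key : ∀ c ∉ exterior (g '' Icc a b), ∀ t ∈ Ioo a b, ∀ s ∈ Icc a b, s ≠ t →
      ‖g t - c‖ = Metric.infDist c (g '' Icc a b) →
      ‖g s - c‖ = Metric.infDist c (g '' Icc a b) → (1 - R) / L ≤ |s - t| := by
    intro c hc t ht s hs hst htc hsc
    have htI := Ioo_subset_Icc_self ht
    by_contra! hlt
    have horth := h.orthogonal_of_nearest ht (c := c) fun w hw => by
      have := Metric.infDist_le_dist_of_mem (x := c) (s := g '' Icc a b) ⟨w, hw, rfl⟩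
      rwa [dist_comm, dist_eq_norm, ← htc] at this
    have := h.norm_sub_lt_of_orthogonal ht hs hst horth fun w hw => by
      have h1 := hLip w (uIcc_subset_Icc htI hs hw) t htI
      have h2 : |w - t| ≤ |s - t| := abs_sub_left_of_mem_uIcc hw
      have h3 := norm_add_le (g w - g t) (g t - c)
      rw [sub_add_sub_cancel, htc] at h3
      have h4 : L * |w - t| ≤ L * |s - t| := by gcongr
      rw [lt_div_iff₀ hL] at hlt
      have h5 := hR c hc
      linarith
    linarith
  refine ⟨min ((1 - R) / L) (b - a), lt_min (div_pos (by linarith) hL) (by linarith [h.lt]), ?_⟩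
  intro c hc t ht s hs hts htc hsc
  rcases ht.1.eq_or_lt with rfl | hat
  · rcases hs.2.eq_or_lt with rfl | hsb
    · exact min_le_right _ _
    · have := key c hc s ⟨hts, hsb⟩ _ ht hts.ne hsc htc
      rw [abs_sub_comm, abs_of_pos (by linarith)] at this
      exact (min_le_left _ _).trans this
  · have := key c hc t ⟨hat, hts.trans_le hs.2⟩ s hs hts.ne' htc hsc
    rw [abs_of_pos (by linarith)] at this
    exact (min_le_left _ _).trans this

/-- The complement of the exterior of the loop contains a closed unit disc. Otherwise every disc with
two contacts would give rise to one whose contacts are closer along the loop, while there is a pair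
of closest contacts. -/
theorem exists_closedBall_subset (h : IsCurvedLoop g v a b) :
    ∃ c, Metric.closedBall c 1 ⊆ (exterior (g '' Icc a b))ᶜ := by
  by_contra! hcon
  have hg := h.continuous
  obtain ⟨σ, hσ, hout⟩ := h.exists_outward
  have hCc := h.isCompact_image
  set C := g '' Icc a b with hC
  have hsubC : C ⊆ (exterior C)ᶜ := fun x hx hx' => hx'.1 hx
  have hFc : IsCompact (exterior C)ᶜ := by
    obtain ⟨M, hM⟩ := hCc.isBounded.subset_closedBall 0
    have hM' : C ⊆ Metric.closedBall 0 |M| :=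
      hM.trans (Metric.closedBall_subset_closedBall (le_abs_self M))
    refine Metric.isCompact_of_isClosed_isBounded (isOpen_exterior hCc).isClosed_compl
      (Metric.isBounded_closedBall.subset (t := Metric.closedBall 0 |M|) fun x hx => ?_)
    rw [Metric.mem_closedBall, dist_eq_norm]
    by_contra! hlt
    exact hx (mem_exterior_of_lt_norm (abs_nonneg M) hM' hlt)
  have hgaC : g a ∈ C := ⟨a, left_mem_Icc.2 h.lt.le, rfl⟩
  obtain ⟨R, hR1, hR⟩ : ∃ R < 1, ∀ c ∉ exterior C, Metric.infDist c C ≤ R := by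
    obtain ⟨c, hc, hmax⟩ := hFc.exists_isMaxOn ⟨g a, hsubC hgaC⟩
      (Metric.continuous_infDist_pt C).continuousOn
    refine ⟨Metric.infDist c C, ?_, fun c' hc' => hmax hc'⟩
    by_contra! hge
    exact hcon c (closedBall_infDist_subset_compl_exterior hCc hc hge)
  obtain ⟨δ, hδ, hsep⟩ := h.exists_le_abs_sub_of_bitangent hR1 hR
  -- Pairs of contacts with their discs; the separation `δ` makes this set compact, as it keeps the
  -- two parameters from merging in a limit.
  set K : Set (ℝ × ℝ × ℂ) := (Icc a b ×ˢ Icc a b ×ˢ (exterior C)ᶜ) ∩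
    ({q | δ ≤ q.2.1 - q.1} ∩ ({q | ‖g q.1 - q.2.2‖ = Metric.infDist q.2.2 C} ∩
      {q | ‖g q.2.1 - q.2.2‖ = Metric.infDist q.2.2 C})) with hK
  have hinf : Continuous fun c => Metric.infDist c C := Metric.continuous_infDist_pt C
  have hKc : IsCompact K := by
    refine (isCompact_Icc.prod (isCompact_Icc.prod hFc)).inter_right ?_
    refine (isClosed_le continuous_const (by fun_prop)).inter
      ((isClosed_eq (by fun_prop) (hinf.comp (by fun_prop))).inter
        (isClosed_eq (by fun_prop) (hinf.comp (by fun_prop))))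
  have hKmem : ∀ t ∈ Icc a b, ∀ s ∈ Icc a b, ∀ c ∉ exterior C, t ≠ s →
      ‖g t - c‖ = Metric.infDist c C → ‖g s - c‖ = Metric.infDist c C →
      ∃ q ∈ K, q.2.1 - q.1 = |t - s| := by
    intro t ht s hs c hc hts htc hsc
    rcases lt_or_gt_of_ne hts with hlt | hlt
    · refine ⟨(t, s, c), ⟨⟨ht, hs, hc⟩, hsep c hc t ht s hs hlt htc hsc, htc, hsc⟩, ?_⟩
      rw [abs_sub_comm, abs_of_pos (by linarith)]
    · refine ⟨(s, t, c), ⟨⟨hs, ht, hc⟩, hsep c hc s hs t ht hlt hsc htc, hsc, htc⟩, ?_⟩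
      rw [abs_of_pos (by linarith)]
  have hbit : ∀ t ∈ Ioo a b, ∃ u : ℝ, 0 < u ∧ ∃ c ∉ exterior C,
      c = g t + u * (σ * (I * unitTangent v t)) ∧ Metric.infDist c C = u ∧ ‖g t - c‖ = u ∧
      ∃ s ∈ Icc a b, s ≠ t ∧ ‖g s - c‖ = u := by
    intro t ht
    obtain ⟨u, hu, s, hs, hst, hcu, hsc⟩ := h.exists_bitangent hσ hout hR1 hR ht
    refine ⟨u, hu, _, h.center_notMem_exterior hσ ht (hout t ht) hu.le hcu.ge, rfl, hcu, ?_,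
      s, hs, hst, hsc⟩
    rw [sub_add_cancel_left]
    simp [h.norm_unitTangent, hσ, abs_of_pos hu]
  have hKn : K.Nonempty := by
    have hmid : (a + b) / 2 ∈ Ioo a b := ⟨by linarith [h.lt], by linarith [h.lt]⟩
    obtain ⟨u, hu, c, hc, -, hcu, htc, s, hs, hst, hsc⟩ := hbit _ hmid
    obtain ⟨q, hq, -⟩ := hKmem _ (Ioo_subset_Icc_self hmid) s hs c hc hst.symm
      (htc.trans hcu.symm) (hsc.trans hcu.symm)
    exact ⟨q, hq⟩
  obtain ⟨⟨t, s, c⟩, ⟨⟨ht, hs, hc⟩, hts, htc, hsc⟩, hmin⟩ := hKc.exists_isMinOn hKn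
    (f := fun q => q.2.1 - q.1) (by fun_prop)
  simp only [mem_ofPred_eq] at ht hs hc hts htc hsc
  have hshort : ∀ x ∈ Icc a b, ∀ y ∈ Icc a b, ∀ c ∉ exterior C, x ≠ y →
      ‖g x - c‖ = Metric.infDist c C → ‖g y - c‖ = Metric.infDist c C → s - t ≤ |x - y| := by
    intro x hx y hy c hc hxy hxc hyc
    obtain ⟨q, hq, hqe⟩ := hKmem x hx y hy c hc hxy hxc hyc
    rw [← hqe]
    exact hmin hq
  -- The midpoint is at distance less than `s - t` from all of `[t, s]`, and it is not a base point.
  set m := (t + s) / 2 with hm_def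
  have htm : t < m := by linarith
  have hms : m < s := by linarith
  have hm : m ∈ Ioo a b := ⟨ht.1.trans_lt htm, hms.trans_le hs.2⟩
  have hmI := Ioo_subset_Icc_self hm
  obtain ⟨u, hu, c', hc', hc'e, hcu, hmc', s', hs', hs'm, hs'c⟩ := hbit m hm
  -- The second disc has no contact on the arc from `t` to `s` apart from `m`.
  have hno : ∀ w ∈ Icc t s, w ≠ m → ‖g w - c'‖ ≠ u := by
    intro w hw hwm hwc
    have := hshort w ⟨ht.1.trans hw.1, hw.2.trans hs.2⟩ m hmI c' hc' hwm
      (hwc.trans hcu.symm) (hmc'.trans hcu.symm)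
    have h2 : |w - m| ≤ (s - t) / 2 := by
      rw [abs_le]
      constructor <;> linarith [hw.1, hw.2]
    linarith
  have hs't : g s' ∉ g '' Icc t s := by
    rintro ⟨w, hw, hws⟩
    refine hno w hw ?_ (hws ▸ hs'c)
    rintro rfl
    exact hs'm (h.eq_of_apply_eq hm hs' hws.symm)
  obtain ⟨x, hx, hx'⟩ := h.exists_mem_segment_of_interlaced hσ hout ht.1 htm hms hs.2 hc htc hsc
    hu hc'e hcu hs' hs'c hs't
  -- Where two radii cross, both their ends are nearest points, so each is a contact of both discs.
  have hcross : ∀ τ ∈ Icc a b, ∀ τ' ∈ Icc a b, ‖g τ - c‖ = Metric.infDist c C →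
      ‖g τ' - c'‖ = u → x ∈ segment ℝ (g τ) c → x ∈ segment ℝ (g τ') c' → ‖g τ - c'‖ = u := by
    intro τ hτ τ' hτ' hτc hτ'c hxτ hxτ'
    have h1 := (mem_segment_iff_wbtw.1 hxτ).dist_add_dist
    have h2 := (mem_segment_iff_wbtw.1 hxτ').dist_add_dist
    have h3 := Metric.infDist_le_dist_of_mem (x := c) (s := C) ⟨τ', hτ', rfl⟩
    have h4 := Metric.infDist_le_dist_of_mem (x := c') (s := C) ⟨τ, hτ, rfl⟩
    have h5 := dist_triangle c x (g τ')
    have h6 := dist_triangle (g τ) x c'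
    rw [← dist_eq_norm] at hτc hτ'c ⊢
    rw [dist_comm c x, dist_comm x (g τ')] at h5
    rw [dist_comm c' (g τ)] at h4
    linarith
  have htI : t ∈ Icc t s := ⟨le_rfl, by linarith⟩
  have hsI : s ∈ Icc t s := ⟨by linarith, le_rfl⟩
  rcases hx with hx | hx <;> rcases hx' with hx' | hx'
  · exact hno t htI htm.ne (hcross t ht m hmI htc hmc' hx hx')
  · exact hno t htI htm.ne (hcross t ht s' hs' htc hs'c hx hx')
  · exact hno s hsI hms.ne' (hcross s hs m hmI hsc hmc' hx hx')
  · exact hno s hsI hms.ne' (hcross s hs s' hs' hsc hs'c hx hx')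

end IsCurvedLoop

/-! ### From the Euclidean plane to the complex plane -/

theorem mem_boundedFigure_of_notMem_exterior (φ : Plane ≃ₗᵢ[ℝ] ℂ) {C : Set Plane} {x : Plane}
    (hx : φ x ∉ exterior (φ '' C)) : x ∈ boundedFigure C := by
  by_cases hxC : x ∈ C
  · exact Or.inl hxC
  refine Or.inr ⟨hxC, ?_⟩
  have hxC' : φ x ∉ φ '' C := by rwa [φ.injective.mem_set_image]
  have hb : Bornology.IsBounded (connectedComponentIn (φ '' C)ᶜ (φ x)) := by
    by_contra hb
    exact hx ⟨hxC', hb⟩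
  have himg : φ '' connectedComponentIn Cᶜ x = connectedComponentIn (φ '' C)ᶜ (φ x) := by
    have := φ.toHomeomorph.image_connectedComponentIn (s := Cᶜ) (x := x) hxC
    rw [φ.toHomeomorph.image_compl] at this
    exact this
  rw [← himg] at hb
  have := φ.symm.lipschitz.isBounded_image hb
  rwa [image_image, image_congr fun y _ => φ.symm_apply_apply y, image_id'] at this

/-- A simple smooth loop of curvature at most `1`, read in complex coordinates and extended by
constants outside of `[a, b]`. -/
theorem IsSimpleSmoothLoop.isCurvedLoop {γ : ℝ → Plane} {a b : ℝ} (hγ : IsSimpleSmoothLoop γ a b)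
    (hcurv : ∀ t ∈ Icc a b, curvature γ a b t ≤ 1) (φ : Plane ≃ₗᵢ[ℝ] ℂ) :
    IsCurvedLoop (fun t => φ (IccExtend hγ.lt.le (fun t : Icc a b => γ t) t))
      (fun t => φ (IccExtend hγ.lt.le (fun t : Icc a b => velocity γ a b t) t)) a b := by
  have hud := uniqueDiffOn_Icc hγ.lt
  have hvs : ContDiffOn ℝ ∞ (velocity γ a b) (Icc a b) :=
    hγ.smooth.derivWithin hud (by simp)
  have hTs : ContDiffOn ℝ ∞ (tangentIndicatrix γ a b) (Icc a b) :=
    ((hvs.norm ℝ hγ.regular).inv fun t ht => norm_ne_zero_iff.2 (hγ.regular t ht)).smul hvs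
  have hg : ∀ t ∈ Icc a b, IccExtend hγ.lt.le (fun t : Icc a b => γ t) t = γ t :=
    fun t ht => IccExtend_of_mem _ _ ht
  have hv : ∀ t ∈ Icc a b, IccExtend hγ.lt.le (fun t : Icc a b => velocity γ a b t) t =
      velocity γ a b t := fun t ht => IccExtend_of_mem _ _ ht
  refine ⟨hγ.lt, φ.continuous.comp hγ.smooth.continuousOn.domRestrict.Icc_extend',
    φ.continuous.comp hvs.continuousOn.domRestrict.Icc_extend', ?_, ?_, ?_, ?_, ?_⟩
  · intro t ht
    have htI := Ioo_subset_Icc_self ht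
    have hn := Icc_mem_nhds ht.1 ht.2
    have h1 : HasDerivAt γ (velocity γ a b t) t :=
      ((hγ.smooth.differentiableOn (by simp)) t htI).hasDerivWithinAt.hasDerivAt hn
    have h2 : HasDerivAt (fun s => φ (γ s)) (φ (velocity γ a b t)) t :=
      φ.toContinuousLinearEquiv.toContinuousLinearMap.hasFDerivAt.comp_hasDerivAt t h1
    simp only [hv t htI]
    refine h2.congr_of_eventuallyEq ?_
    filter_upwards [hn] with s hs
    rw [hg s hs]
  · intro t
    rw [ne_eq, φ.map_eq_zero_iff]
    exact hγ.regular _ (projIcc a b hγ.lt.le t).2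
  · simp only [hg a (left_mem_Icc.2 hγ.lt.le), hg b (right_mem_Icc.2 hγ.lt.le), hγ.closed]
  · intro s hs t ht hst
    simp only [hg s (Ico_subset_Icc_self hs), hg t (Ico_subset_Icc_self ht)] at hst
    exact hγ.simple hs ht (φ.injective hst)
  · intro t ht
    have htI := Ioo_subset_Icc_self ht
    have hn := Icc_mem_nhds ht.1 ht.2
    have h1 := ((hTs.differentiableOn (by simp)) t htI).hasDerivWithinAt.hasDerivAt hn
    have h2 := φ.toContinuousLinearEquiv.toContinuousLinearMap.hasFDerivAt.comp_hasDerivAt t h1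
    refine ⟨_, h2.congr_of_eventuallyEq ?_, ?_⟩
    · filter_upwards [hn] with s hs
      simp [unitTangent, hv s hs, tangentIndicatrix]
    · have h3 := hcurv t htI
      rw [curvature, div_le_one (norm_pos_iff.2 (hγ.regular t htI))] at h3
      simpa [hv t htI] using h3

theorem mainTheorem1 (γ : ℝ → Plane) (a b : ℝ) (hγ : IsSimpleSmoothLoop γ a b)
    (hcurv : ∀ t ∈ Set.Icc a b, curvature γ a b t ≤ 1) :
    ∃ c : Plane, Metric.closedBall c 1 ⊆ boundedFigure (γ '' Set.Icc a b) := by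
  set φ : Plane ≃ₗᵢ[ℝ] ℂ := Complex.orthonormalBasisOneI.repr.symm
  obtain ⟨c, hc⟩ := (hγ.isCurvedLoop hcurv φ).exists_closedBall_subset
  have himg : (fun t => φ (IccExtend hγ.lt.le (fun t : Icc a b => γ t) t)) '' Icc a b =
      φ '' (γ '' Icc a b) := by
    rw [image_image]
    exact image_congr fun t ht => by rw [IccExtend_of_mem _ _ ht]
  rw [himg] at hc
  refine ⟨φ.symm c, fun x hx => mem_boundedFigure_of_notMem_exterior φ (hc ?_)⟩
  rw [Metric.mem_closedBall] at hx ⊢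
  rwa [← φ.dist_map, φ.apply_symm_apply] at hx
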